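/- All spaces, maps and homotopies are pointed. Let $\Sigma$, $\mathrm{C}$ and $\mathbb{I}$ denote the reduced suspension, cone and cylinder. For pointed spaces $A$, $X$ put $\pi^A_n(X)=[\Sigma^nA,X]$ (pointed homotopy classes of pointed maps), $n\ge 0$. Let $A$ be a pointed space. - A pointed map $f:X\to Y$ is an *$A$-weak equivalence* if $f_*:\pi^A_n(X)\to\pi^A_n(Y)$ is bijective for all $n\ge 0$. - A pointed map is an *$A$-fibration* if it has the pointed homotopy lifting property with respect to $A$, to $\mathrm{C}\Sigma^{n-1}A$ for all $n\ge 1$, and to $\mathbb{I}^nA$ for all $n\ge 1$. - A pointed map is an *$A$-cofibration* if it has the left lifting property with respect to all maps that are both $A$-fibrations and $A$-weak equivalences. A pointed space $X$ is *$A$-cofibrant* if $\ast\to X$ is an $A$-cofibration. - $X$ is *obtained from $B$ by attaching $A$-cells*, via a map $B\to X$, if this map is the pushout, along some map $\bigvee_{\alpha\in J}\Sigma^{n_\alpha-1}A\to B$, of the canonical map $\bigvee_{\alpha\in J}\Sigma^{n_\alpha-1}A\to\bigl(\bigvee_{J_0}A\bigr)\vee\bigvee_{\alpha\in J}\mathrm{C}\Sigma^{n_\alpha-1}A$,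 for some sets $J_0$, $J$ and integers $n_\alpha\ge 1$. $X$ is a *generalized CW($A$)-complex* if it is the colimit of a sequence $\ast=X^0\to X^1\to X^2\to\cdots$ in which each $X^{n}$, $n\ge 1$, is obtained from $X^{n-1}$ by attaching $A$-cells via the map $X^{n-1}\to X^n$. **Theorem.** Let $A$ be a compact $T_1$ pointed space which is an $H$-cogroup (it has a comultiplication $A\to A\vee A$ which is, up to pointed homotopy, coassociative, with the constant map as two-sided counit, and with a two-sided inverse $A\to A$). Let $f:X\to Y$ be an $A$-weak equivalence. If $X$ and $Y$ are $A$-cofibrant spaces, then $f$ is a (pointed) homotopy equivalence. In particular, this holds if $X$ and $Y$ are generalized CW($A$)-complexes. -/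

import Mathlib

open CategoryTheory

universe u

/-- A pointed topological space. -/
structure PtdTop : Type (u + 1) where
  carrier : Type u
  [top : TopologicalSpace carrier]
  pt : carrier

namespace PtdTop

instance : CoeSort PtdTop.{u} (Type u) := ⟨PtdTop.carrier⟩

instance (X : PtdTop.{u}) : TopologicalSpace X := X.top

/-- Pointed continuous maps. -/
@[ext]
structure Hom (X Y : PtdTop.{u}) where
  map : C(X, Y)
  map_pt : map X.pt = Y.pt

/-- The category of pointed topological spaces and pointed continuous maps. -/
instance : Category.{u} PtdTop.{u} where
  Hom X Y := Hom X Y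
  id X := ⟨ContinuousMap.id X, rfl⟩
  comp f g := ⟨g.map.comp f.map, by simp [f.map_pt, g.map_pt]⟩

/-- The one-point space. -/
def point : PtdTop.{u} := ⟨PUnit, PUnit.unit⟩

/-- The constant map with value the base point. -/
def const (X Y : PtdTop.{u}) : X ⟶ Y := ⟨ContinuousMap.const X Y.pt, rfl⟩

/-! ### Homotopies relative to the base point -/

/-- Pointed maps are homotopic if they are homotopic relative to the base point. -/
def Homotopic {X Y : PtdTop.{u}} (f g : X ⟶ Y) : Prop :=
  ContinuousMap.HomotopicRel f.map g.map {X.pt}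

/-- Pointed homotopy as an equivalence relation on the set of pointed maps. -/
def homotopySetoid (X Y : PtdTop.{u}) : Setoid (X ⟶ Y) where
  r f g := Homotopic f g
  iseqv := ⟨fun f => ContinuousMap.HomotopicRel.refl f.map,
    fun h => ContinuousMap.HomotopicRel.symm h,
    fun h h' => ContinuousMap.HomotopicRel.trans h h'⟩

/-- The set `[X, Y]` of pointed homotopy classes of pointed maps. -/
def HomotopyClasses (X Y : PtdTop.{u}) : Type u := Quotient (homotopySetoid X Y)

/-- The map `f_* : [Z, X] → [Z, Y]` induced by `f : X ⟶ Y`. -/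
def HomotopyClasses.postcomp (Z : PtdTop.{u}) {X Y : PtdTop.{u}} (f : X ⟶ Y) :
    HomotopyClasses Z X → HomotopyClasses Z Y :=
  Quotient.map (sa := homotopySetoid Z X) (sb := homotopySetoid Z Y) (fun g => g ≫ f)
    (fun _ _ h => ContinuousMap.HomotopicRel.comp_continuousMap h f.map)

/-- Pointed homotopy equivalences. -/
def IsHomotopyEquivalence {X Y : PtdTop.{u}} (f : X ⟶ Y) : Prop :=
  ∃ g : Y ⟶ X, Homotopic (f ≫ g) (𝟙 X) ∧ Homotopic (g ≫ f) (𝟙 Y)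

/-! ### Collapsing a subset -/

/-- The equivalence relation on `T` whose only non-trivial class is `S`. -/
def collapseSetoid {T : Type u} (S : Set T) : Setoid T where
  r x y := x = y ∨ (x ∈ S ∧ y ∈ S)
  iseqv := ⟨fun _ => Or.inl rfl, by rintro x y (h | h) <;> tauto,
    by rintro x y z (rfl | h) (rfl | h') <;> tauto⟩

/-- The quotient space `T / S`, with the class of a given `t ∈ S` as base point. -/
def collapse (T : Type u) [TopologicalSpace T] (S : Set T) (t : S) : PtdTop.{u} :=
  ⟨Quotient (collapseSetoid S), Quotient.mk (collapseSetoid S) t⟩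

/-- The quotient map `T → T / S`. -/
def collapseMk (T : Type u) [TopologicalSpace T] (S : Set T) (t : S) : C(T, collapse T S t) :=
  ⟨Quotient.mk (collapseSetoid S), continuous_quotient_mk'⟩

theorem collapseMk_eq {T : Type u} [TopologicalSpace T] {S : Set T} (t : S) {x : T}
    (hx : x ∈ S) : collapseMk T S t x = (collapse T S t).pt :=
  Quotient.sound (s := collapseSetoid S) (Or.inr ⟨hx, t.2⟩)

/-- A continuous map on `T` that sends `S` to the base point descends to `T / S`. -/
def collapseDesc {T : Type u} [TopologicalSpace T] {S : Set T} (t : S) {Z : PtdTop.{u}}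
    (f : C(T, Z)) (hf : ∀ x ∈ S, f x = Z.pt) : collapse T S t ⟶ Z where
  map := ⟨Quotient.lift (s := collapseSetoid S) f (by
      rintro x y (rfl | ⟨hx, hy⟩)
      · rfl
      · rw [hf x hx, hf y hy]),
    Continuous.quotient_lift (s := collapseSetoid S) f.continuous _⟩
  map_pt := hf t t.2

/-! ### Reduced cylinder, cone and suspension -/

/-- The reduced cylinder `X × I / {*} × I`. -/
def cylinder (X : PtdTop.{u}) : PtdTop.{u} :=
  collapse (X × unitInterval) {z | z.1 = X.pt} ⟨(X.pt, 0), rfl⟩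

/-- The inclusion of `X` as the bottom of its reduced cylinder. -/
def cylinderBottom (X : PtdTop.{u}) : X ⟶ cylinder X where
  map := (collapseMk (X × unitInterval) {z | z.1 = X.pt} ⟨(X.pt, 0), rfl⟩).comp
    ⟨fun x => (x, 0), by fun_prop⟩
  map_pt := rfl

/-- The reduced cone `X × I / (X × {0} ∪ {*} × I)`. -/
def cone (X : PtdTop.{u}) : PtdTop.{u} :=
  collapse (X × unitInterval) {z | z.2 = 0 ∨ z.1 = X.pt} ⟨(X.pt, 0), Or.inl rfl⟩

/-- The inclusion `x ↦ [x, 1]` of `X` as the base of its reduced cone. -/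
def coneBase (X : PtdTop.{u}) : X ⟶ cone X where
  map := (collapseMk (X × unitInterval) {z | z.2 = 0 ∨ z.1 = X.pt}
    ⟨(X.pt, 0), Or.inl rfl⟩).comp ⟨fun x => (x, 1), by fun_prop⟩
  map_pt := collapseMk_eq _ (Or.inr rfl)

/-- The reduced suspension `X × I / (X × {0, 1} ∪ {*} × I)`. -/
def suspension (X : PtdTop.{u}) : PtdTop.{u} :=
  collapse (X × unitInterval) {z | z.2 = 0 ∨ z.2 = 1 ∨ z.1 = X.pt} ⟨(X.pt, 0), Or.inl rfl⟩

/-- The iterated reduced suspension `Σⁿ X`. -/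
def iterSuspension (n : ℕ) (X : PtdTop.{u}) : PtdTop.{u} := suspension^[n] X

/-- The iterated reduced cylinder `𝕀ⁿ X`. -/
def iterCylinder (n : ℕ) (X : PtdTop.{u}) : PtdTop.{u} := cylinder^[n] X

/-! ### Wedges -/

/-- The wedge `⋁_{j ∈ J} X j`: the disjoint union of the `X j` and one extra point, with all
the base points and the extra point identified. (The extra point makes the wedge of the empty
family the one-point space.) -/
def wedge {J : Type u} (X : J → PtdTop.{u}) : PtdTop.{u} :=
  collapse (PUnit.{u + 1} ⊕ (Σ j, X j))
    {z | z = Sum.inl PUnit.unit ∨ ∃ j, z = Sum.inr ⟨j, (X j).pt⟩}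
    ⟨Sum.inl PUnit.unit, Or.inl rfl⟩

/-- The inclusion of a summand of a wedge. -/
def wedgeIn {J : Type u} (X : J → PtdTop.{u}) (j : J) : X j ⟶ wedge X where
  map := (collapseMk (PUnit.{u + 1} ⊕ (Σ j, X j))
    {z | z = Sum.inl PUnit.unit ∨ ∃ j, z = Sum.inr ⟨j, (X j).pt⟩}
    ⟨Sum.inl PUnit.unit, Or.inl rfl⟩).comp
      ⟨fun x => Sum.inr ⟨j, x⟩, continuous_inr.comp continuous_sigmaMk⟩
  map_pt := collapseMk_eq _ (Or.inr ⟨j, rfl⟩)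

/-- The map out of a wedge given by its restrictions to the summands. -/
def wedgeDesc {J : Type u} {X : J → PtdTop.{u}} {Z : PtdTop.{u}} (f : ∀ j, X j ⟶ Z) :
    wedge X ⟶ Z :=
  collapseDesc _
    ⟨Sum.elim (fun _ => Z.pt) (fun x => (f x.1).map x.2),
      continuous_const.sumElim (continuous_sigma fun j => (f j).map.continuous)⟩
    (by
      rintro x (rfl | ⟨j, rfl⟩)
      · rfl
      · exact (f j).map_pt)

/-- The wedge `X ∨ Y` of two pointed spaces. -/
def wedge₂ (X Y : PtdTop.{u}) : PtdTop.{u} :=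
  collapse (X ⊕ Y) {z | z = Sum.inl X.pt ∨ z = Sum.inr Y.pt} ⟨Sum.inl X.pt, Or.inl rfl⟩

/-- The inclusion `X ⟶ X ∨ Y`. -/
def wedge₂Inl (X Y : PtdTop.{u}) : X ⟶ wedge₂ X Y where
  map := (collapseMk (X ⊕ Y) {z | z = Sum.inl X.pt ∨ z = Sum.inr Y.pt}
    ⟨Sum.inl X.pt, Or.inl rfl⟩).comp ⟨Sum.inl, continuous_inl⟩
  map_pt := rfl

/-- The inclusion `Y ⟶ X ∨ Y`. -/
def wedge₂Inr (X Y : PtdTop.{u}) : Y ⟶ wedge₂ X Y where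
  map := (collapseMk (X ⊕ Y) {z | z = Sum.inl X.pt ∨ z = Sum.inr Y.pt}
    ⟨Sum.inl X.pt, Or.inl rfl⟩).comp ⟨Sum.inr, continuous_inr⟩
  map_pt := collapseMk_eq _ (Or.inr rfl)

/-- The map `f + g : X ∨ Y ⟶ Z`. -/
def wedge₂Desc {X Y Z : PtdTop.{u}} (f : X ⟶ Z) (g : Y ⟶ Z) : wedge₂ X Y ⟶ Z :=
  collapseDesc _ ⟨Sum.elim f.map g.map, f.map.continuous.sumElim g.map.continuous⟩
    (by
      rintro x (rfl | rfl)
      · exact f.map_pt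
      · exact g.map_pt)

/-- The map `f ∨ g : X ∨ Y ⟶ X' ∨ Y'`. -/
def wedge₂Map {X Y X' Y' : PtdTop.{u}} (f : X ⟶ X') (g : Y ⟶ Y') :
    wedge₂ X Y ⟶ wedge₂ X' Y' :=
  wedge₂Desc (f ≫ wedge₂Inl X' Y') (g ≫ wedge₂Inr X' Y')

/-- The canonical map `(X ∨ Y) ∨ Z ⟶ X ∨ (Y ∨ Z)`. -/
def wedge₂Assoc (X Y Z : PtdTop.{u}) : wedge₂ (wedge₂ X Y) Z ⟶ wedge₂ X (wedge₂ Y Z) :=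
  wedge₂Desc
    (wedge₂Desc (wedge₂Inl X (wedge₂ Y Z)) (wedge₂Inl Y Z ≫ wedge₂Inr X (wedge₂ Y Z)))
    (wedge₂Inr Y Z ≫ wedge₂Inr X (wedge₂ Y Z))

/-! ### H-cogroups -/

/-- `A` is an H-cogroup: it admits a comultiplication `ν : A ⟶ A ∨ A` and a map `ι : A ⟶ A`
such that, up to pointed homotopy, `ν` is coassociative, the constant map is a two-sided counit
and `ι` is a two-sided inverse. -/
def IsHCogroup (A : PtdTop.{u}) : Prop :=
  ∃ (ν : A ⟶ wedge₂ A A) (ι : A ⟶ A),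
    Homotopic (ν ≫ wedge₂Map ν (𝟙 A) ≫ wedge₂Assoc A A A) (ν ≫ wedge₂Map (𝟙 A) ν) ∧
    Homotopic (ν ≫ wedge₂Desc (𝟙 A) (const A A)) (𝟙 A) ∧
    Homotopic (ν ≫ wedge₂Desc (const A A) (𝟙 A)) (𝟙 A) ∧
    Homotopic (ν ≫ wedge₂Desc (𝟙 A) ι) (const A A) ∧
    Homotopic (ν ≫ wedge₂Desc ι (𝟙 A)) (const A A)

/-! ### `A`-weak equivalences, `A`-fibrations and `A`-cofibrations -/

/-- `π_n^A(X) = [Σⁿ A, X]`. -/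
abbrev piA (A : PtdTop.{u}) (n : ℕ) (X : PtdTop.{u}) : Type u :=
  HomotopyClasses (iterSuspension n A) X

/-- The class of `A`-weak equivalences: the maps that induce bijections on `π_n^A` for all
`n ≥ 0`. -/
def weakEquivalencesA (A : PtdTop.{u}) : MorphismProperty PtdTop.{u} := fun X Y f =>
  ∀ n : ℕ, Function.Bijective
    (HomotopyClasses.postcomp (iterSuspension n A) f : piA A n X → piA A n Y)

/-- The (pointed) homotopy lifting property of `p` with respect to `Z`. -/
def HasHLP {E B : PtdTop.{u}} (p : E ⟶ B) (Z : PtdTop.{u}) : Prop :=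
  HasLiftingProperty (cylinderBottom Z) p

/-- The class of `A`-fibrations: the maps with the homotopy lifting property with respect to `A`,
to `C Σⁿ⁻¹ A` for `n ≥ 1`, and to `𝕀ⁿ A` for `n ≥ 1`. -/
def fibrationsA (A : PtdTop.{u}) : MorphismProperty PtdTop.{u} := fun _ _ p =>
  HasHLP p A ∧ (∀ n : ℕ, HasHLP p (cone (iterSuspension n A))) ∧
    ∀ n : ℕ, HasHLP p (iterCylinder (n + 1) A)

/-- The class of `A`-cofibrations: the maps with the left lifting property with respect to the
`A`-fibrations that are `A`-weak equivalences. -/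
def cofibrationsA (A : PtdTop.{u}) : MorphismProperty PtdTop.{u} :=
  (fibrationsA A ⊓ weakEquivalencesA A).llp

/-- `X` is `A`-cofibrant if `* ⟶ X` is an `A`-cofibration. -/
def IsCofibrantA (A X : PtdTop.{u}) : Prop := cofibrationsA A (const point X)

/-! ### Generalized CW(`A`)-complexes -/

/-- The cells attached in one step: copies of `A` indexed by `J₀`, and cones `C Σ^(m α) A`
indexed by `α : J`. The cone `C Σ^(m α) A` is a cell of dimension `m α + 1`. -/
def cells (A : PtdTop.{u}) {J₀ J : Type u} (m : J → ℕ) : J₀ ⊕ J → PtdTop.{u} :=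
  Sum.elim (fun _ => A) (fun α => cone (iterSuspension (m α) A))

/-- The inclusion `⋁_{α ∈ J} Σ^(m α) A ⟶ (⋁_{J₀} A) ∨ (⋁_{α ∈ J} C Σ^(m α) A)`. -/
def cellBoundary (A : PtdTop.{u}) {J₀ J : Type u} (m : J → ℕ) :
    wedge (fun α : J => iterSuspension (m α) A) ⟶ wedge (cells A (J₀ := J₀) m) :=
  wedgeDesc fun α => coneBase (iterSuspension (m α) A) ≫ wedgeIn (cells A m) (Sum.inr α)

/-- `j : B ⟶ X` exhibits `X` as obtained from `B` by attaching `A`-cells. -/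
def IsCellAttachment (A : PtdTop.{u}) {B X : PtdTop.{u}} (j : B ⟶ X) : Prop :=
  ∃ (J₀ J : Type u) (m : J → ℕ) (g : wedge (fun α : J => iterSuspension (m α) A) ⟶ B)
    (f : wedge (cells A (J₀ := J₀) m) ⟶ X), IsPushout g (cellBoundary A m) j f

/-- `X` is a generalized CW(`A`)-complex: it is the colimit, in the category of pointed spaces,
of a sequence `* = X⁰ ⟶ X¹ ⟶ X² ⟶ ⋯` in which each space is obtained from the preceding one by
attaching `A`-cells. -/
def IsGeneralizedCW (A X : PtdTop.{u}) : Prop :=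
  ∃ (F : ℕ ⥤ PtdTop.{u}) (c : Limits.Cocone F),
    Subsingleton (F.obj 0) ∧
    (∀ n : ℕ, IsCellAttachment A (F.map (homOfLE (Nat.le_succ n)))) ∧
    c.pt = X ∧ Nonempty (Limits.IsColimit c)

end PtdTop

namespace PtdTop

open unitInterval

/-! ### Pointed homotopies -/

/-! Factor `f` through its mapping path space as a homotopy equivalence followed by the endpoint
projection `p`. By two-out-of-three `p` is an `A`-weak equivalence, and it is a fibration in the
strong sense of `IsBasedFibration`. If `𝟙 Y` lifts along such maps, a section of `p` gives `g : Y ⟶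
X` with `g ≫ f` homotopic to `𝟙 Y`, and `g` is again an `A`-weak equivalence. Applying this to `g`
gives `k` with `k ≫ g ≃ 𝟙 X`; then `f ≃ k ≫ g ≫ f ≃ k`, so `g` inverts `f` on both sides.

It remains to lift. Based fibrations are `A`-fibrations, so cofibrant spaces lift by definition. For
generalized CW(`A`)-complexes the lift is built cell by cell: copies of `A` lift by surjectivity on
`π_0^A`, and cones by `IsBasedFibration.hasLiftingProperty_coneBase`, a difference-element argument
using injectivity on `[K, -]` and surjectivity on `[ΣK, -]`. -/

theorem homotopic_iff {X Y : PtdTop.{u}} {f g : X ⟶ Y} :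
    Homotopic f g ↔ ∃ H : C(X × I, Y), (∀ x, H (x, 0) = f.map x) ∧
      (∀ x, H (x, 1) = g.map x) ∧ ∀ t, H (X.pt, t) = Y.pt := by
  constructor
  · rintro ⟨H⟩
    refine ⟨⟨fun z => H (z.2, z.1), by fun_prop⟩, fun x => H.apply_zero x, fun x => H.apply_one x,
      fun t => ?_⟩
    exact (H.eq_fst t rfl).trans f.map_pt
  · rintro ⟨H, h0, h1, hpt⟩
    refine ⟨⟨⟨⟨fun z => H (z.2, z.1), by fun_prop⟩, h0, h1⟩, ?_⟩⟩
    rintro t x rfl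
    exact (hpt t).trans f.map_pt.symm

theorem Homotopic.symm {X Y : PtdTop.{u}} {f g : X ⟶ Y} (h : Homotopic f g) : Homotopic g f :=
  ContinuousMap.HomotopicRel.symm h

theorem Homotopic.trans {X Y : PtdTop.{u}} {f g k : X ⟶ Y} (h : Homotopic f g)
    (h' : Homotopic g k) : Homotopic f k :=
  ContinuousMap.HomotopicRel.trans h h'

theorem Homotopic.comp_right {X Y Z : PtdTop.{u}} {f g : X ⟶ Y} (h : Homotopic f g) (k : Y ⟶ Z) :
    Homotopic (f ≫ k) (g ≫ k) :=
  ContinuousMap.HomotopicRel.comp_continuousMap h k.map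

theorem Homotopic.comp_left {X Y Z : PtdTop.{u}} (k : X ⟶ Y) {f g : Y ⟶ Z} (h : Homotopic f g) :
    Homotopic (k ≫ f) (k ≫ g) := by
  obtain ⟨H, h0, h1, hpt⟩ := homotopic_iff.1 h
  refine homotopic_iff.2 ⟨⟨fun z => H (k.map z.1, z.2), by fun_prop⟩, fun x => h0 _,
    fun x => h1 _, fun t => ?_⟩
  simpa [k.map_pt] using hpt t

theorem hom_ext {X Y : PtdTop.{u}} {f g : X ⟶ Y} (h : ∀ x, f.map x = g.map x) : f = g :=
  Hom.ext (ContinuousMap.ext h)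

theorem postcomp_injective_iff {Z X Y : PtdTop.{u}} {f : X ⟶ Y} :
    Function.Injective (HomotopyClasses.postcomp Z f) ↔
      ∀ g g' : Z ⟶ X, Homotopic (g ≫ f) (g' ≫ f) → Homotopic g g' := by
  constructor
  · intro h g g' H
    exact Quotient.exact (s := homotopySetoid Z X)
      (h (a₁ := Quotient.mk (homotopySetoid Z X) g) (a₂ := Quotient.mk (homotopySetoid Z X) g')
        (Quotient.sound (s := homotopySetoid Z Y) H))
  · intro h a b
    refine Quotient.inductionOn₂ (s₁ := homotopySetoid Z X) (s₂ := homotopySetoid Z X) a b ?_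
    intro g g' H
    exact Quotient.sound (s := homotopySetoid Z X)
      (h g g' (Quotient.exact (s := homotopySetoid Z Y) H))

theorem postcomp_surjective_iff {Z X Y : PtdTop.{u}} {f : X ⟶ Y} :
    Function.Surjective (HomotopyClasses.postcomp Z f) ↔
      ∀ g : Z ⟶ Y, ∃ g' : Z ⟶ X, Homotopic (g' ≫ f) g := by
  constructor
  · intro h g
    obtain ⟨a, ha⟩ := h (Quotient.mk (homotopySetoid Z Y) g)
    induction a using Quotient.inductionOn with
    | h g' => exact ⟨g', Quotient.exact (s := homotopySetoid Z Y) ha⟩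
  · intro h b
    refine Quotient.inductionOn (s := homotopySetoid Z Y) b fun g => ?_
    obtain ⟨g', H⟩ := h g
    exact ⟨Quotient.mk (homotopySetoid Z X) g', Quotient.sound (s := homotopySetoid Z Y) H⟩

theorem postcomp_comp (Z : PtdTop.{u}) {X Y W : PtdTop.{u}} (f : X ⟶ Y) (g : Y ⟶ W) :
    HomotopyClasses.postcomp Z (f ≫ g) =
      HomotopyClasses.postcomp Z g ∘ HomotopyClasses.postcomp Z f := by
  funext a
  exact Quotient.inductionOn (s := homotopySetoid Z X) a fun _ => rfl

theorem postcomp_eq_of_homotopic (Z : PtdTop.{u}) {X Y : PtdTop.{u}} {f g : X ⟶ Y}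
    (h : Homotopic f g) : HomotopyClasses.postcomp Z f = HomotopyClasses.postcomp Z g := by
  funext a
  exact Quotient.inductionOn (s := homotopySetoid Z X) a fun k =>
    Quotient.sound (s := homotopySetoid Z Y) (h.comp_left k)

theorem postcomp_id (Z X : PtdTop.{u}) : HomotopyClasses.postcomp Z (𝟙 X) = id := by
  funext a
  exact Quotient.inductionOn (s := homotopySetoid Z X) a fun _ => rfl

/-- Homotopy equivalences induce bijections on homotopy classes. -/
theorem IsHomotopyEquivalence.postcomp_bijective {X Y : PtdTop.{u}} {f : X ⟶ Y}
    (hf : IsHomotopyEquivalence f) (Z : PtdTop.{u}) :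
    Function.Bijective (HomotopyClasses.postcomp Z f) := by
  obtain ⟨g, h, h'⟩ := hf
  refine Function.bijective_iff_has_inverse.2 ⟨HomotopyClasses.postcomp Z g, ?_, ?_⟩
  · refine Function.leftInverse_iff_comp.2 ?_
    rw [← postcomp_comp, postcomp_eq_of_homotopic Z h, postcomp_id]
  · refine Function.rightInverse_iff_comp.2 ?_
    rw [← postcomp_comp, postcomp_eq_of_homotopic Z h', postcomp_id]

/-! ### Based fibrations -/

/-- The homotopy lifting property for all spaces, where the lift can be taken constant at the
base point over the points at which the given data are constant at the base point. -/
def IsBasedFibration {E B : PtdTop.{u}} (p : E ⟶ B) : Prop :=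
  ∀ (T : Type u) [TopologicalSpace T] (h : C(T, E)) (H : C(T × I, B)),
    (∀ x, H (x, 0) = p.map (h x)) →
    ∃ K : C(T × I, E), (∀ z, p.map (K z) = H z) ∧ (∀ x, K (x, 0) = h x) ∧
      ∀ x, h x = E.pt → (∀ t, H (x, t) = B.pt) → ∀ t, K (x, t) = E.pt

/-- The base-point clause makes the lift on `Z × I` constant on `{*} × I`, so it descends to the
reduced cylinder. -/
theorem IsBasedFibration.hasHLP {E B : PtdTop.{u}} {p : E ⟶ B} (hp : IsBasedFibration p)
    (Z : PtdTop.{u}) : HasHLP p Z where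
  sq_hasLift {a b} sq := by
    let q := collapseMk (Z × I) {z | z.1 = Z.pt} ⟨(Z.pt, 0), rfl⟩
    obtain ⟨K, hK, hK0, hpt⟩ := hp Z a.map (b.map.comp q)
      fun x => (congrArg (fun k => Hom.map k x) sq.w).symm
    have hK1 : ∀ z ∈ {z : Z × I | z.1 = Z.pt}, K z = E.pt := by
      rintro ⟨x, t⟩ (rfl : x = Z.pt)
      refine hpt _ a.map_pt (fun s => ?_) t
      exact (congrArg b.map (collapseMk_eq (T := Z × I) (S := {z | z.1 = Z.pt})
        ⟨(Z.pt, 0), rfl⟩ rfl)).trans b.map_pt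
    refine ⟨⟨⟨collapseDesc _ K hK1, hom_ext fun x => hK0 x, hom_ext fun x => ?_⟩⟩⟩
    induction x using Quotient.inductionOn with
    | h z => exact hK z

/-- A map that lifts up to homotopy along a based fibration lifts. -/
theorem IsBasedFibration.exists_lift {E B : PtdTop.{u}} {p : E ⟶ B} (hp : IsBasedFibration p)
    {Z : PtdTop.{u}} (hs : Function.Surjective (HomotopyClasses.postcomp Z p)) (v : Z ⟶ B) :
    ∃ w : Z ⟶ E, w ≫ p = v := by
  obtain ⟨w, hw⟩ := postcomp_surjective_iff.1 hs v
  obtain ⟨H, h0, h1, hpt⟩ := homotopic_iff.1 hw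
  obtain ⟨K, hK, hK0, hKpt⟩ := hp Z w.map H h0
  exact ⟨⟨⟨fun x => K (x, 1), by fun_prop⟩, hKpt _ w.map_pt hpt 1⟩,
    hom_ext fun x => (hK _).trans (h1 x)⟩

/-! ### The mapping path space -/

/-- The space of pairs of a point `x : X` and a path in `Y` that starts at `f x`. -/
def mappingPathSpace {X Y : PtdTop.{u}} (f : X ⟶ Y) : PtdTop.{u} :=
  ⟨{z : X × C(I, Y) // z.2 0 = f.map z.1},
    ⟨(X.pt, ContinuousMap.const I Y.pt), f.map_pt.symm⟩⟩

/-- The endpoint projection of the mapping path space. -/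
def mappingPathEnd {X Y : PtdTop.{u}} (f : X ⟶ Y) : mappingPathSpace f ⟶ Y where
  map := ⟨fun z => z.1.2 1, by
    have h : Continuous fun z : {z : X × C(I, Y) // z.2 0 = f.map z.1} => z.1.2 1 := by fun_prop
    exact h⟩
  map_pt := rfl

/-- The projection of the mapping path space to the source. -/
def mappingPathFst {X Y : PtdTop.{u}} (f : X ⟶ Y) : mappingPathSpace f ⟶ X where
  map := ⟨fun z => z.1.1, continuous_fst.comp continuous_subtype_val⟩
  map_pt := rfl

/-- The inclusion of the source in the mapping path space, by constant paths. -/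
def mappingPathIn {X Y : PtdTop.{u}} (f : X ⟶ Y) : X ⟶ mappingPathSpace f where
  map := ⟨fun x => ⟨(x, ContinuousMap.const I (f.map x)), rfl⟩,
    Continuous.subtype_mk (continuous_id.prodMk
      (ContinuousMap.continuous_const'.comp f.map.continuous)) _⟩
  map_pt := Subtype.ext (Prod.ext rfl (ContinuousMap.ext fun _ => f.map_pt))

theorem mappingPathIn_comp_end {X Y : PtdTop.{u}} (f : X ⟶ Y) :
    mappingPathIn f ≫ mappingPathEnd f = f := rfl

/-- A continuous map to the mapping path space from its two components. -/
def mappingPathLift {X Y : PtdTop.{u}} (f : X ⟶ Y) {T : Type u} [TopologicalSpace T]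
    (a : C(T, X)) (b : C(T × I, Y)) (h : ∀ x, b (x, 0) = f.map (a x)) :
    C(T, mappingPathSpace f) :=
  ⟨fun x => ⟨(a x, b.curry x), h x⟩,
    Continuous.subtype_mk (a.continuous.prodMk b.curry.continuous) _⟩

theorem continuous_mappingPath_eval {X Y : PtdTop.{u}} (f : X ⟶ Y) :
    Continuous fun z : mappingPathSpace f × I => z.1.1.2 z.2 := by
  have h : Continuous fun z : {z : X × C(I, Y) // z.2 0 = f.map z.1} × I => z.1.1.2 z.2 := by
    fun_prop
  exact h

/-- Each path contracts to its starting point by the reparametrisation `t ↦ s * t`. -/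
theorem mappingPathIn_isHomotopyEquivalence {X Y : PtdTop.{u}} (f : X ⟶ Y) :
    IsHomotopyEquivalence (mappingPathIn f) := by
  refine ⟨mappingPathFst f, ContinuousMap.HomotopicRel.refl _, homotopic_iff.2 ?_⟩
  refine ⟨mappingPathLift f ⟨fun z => z.1.1.1, ?_⟩ ⟨fun z => z.1.1.1.2 (z.1.2 * z.2), ?_⟩ ?_,
    ?_, ?_, ?_⟩
  · exact (mappingPathFst f).map.continuous.comp continuous_fst
  · have h : Continuous fun z : (mappingPathSpace f × I) × I => (z.1.1, z.1.2 * z.2) := by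
      fun_prop
    exact (continuous_mappingPath_eval f).comp h
  · rintro ⟨z, s⟩
    simpa using! z.2
  · intro z
    refine Subtype.ext (Prod.ext rfl (ContinuousMap.ext fun t => ?_))
    change z.1.2 (0 * t) = f.map z.1.1
    rw [zero_mul]
    exact z.2
  · intro z
    refine Subtype.ext (Prod.ext rfl (ContinuousMap.ext fun t => ?_))
    change z.1.2 (1 * t) = z.1.2 t
    rw [one_mul]
  · exact fun t => rfl

/-- The lift at time `t` appends `H (x, ·)` on `[0, t]` to the path of `h x`; a constant path
extended by a constant one stays constant. -/
theorem mappingPathEnd_isBasedFibration {X Y : PtdTop.{u}} (f : X ⟶ Y) :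
    IsBasedFibration (mappingPathEnd f) := by
  intro T _ h H hH
  have h01 : (0 : ℝ) ≤ 1 := zero_le_one
  let γ : C(T × ℝ, Y) := ⟨fun z => (h z.1).1.2 (Set.projIcc 0 1 h01 z.2),
    (continuous_mappingPath_eval f).comp
      (f := fun z : T × ℝ => (h z.1, Set.projIcc 0 1 h01 z.2)) (by fun_prop)⟩
  let η : C(T × ℝ, Y) := ⟨fun z => H (z.1, Set.projIcc 0 1 h01 z.2), by fun_prop⟩
  -- The concatenated path has length `1 + t` and is traversed at that speed, so that at `t = 0` it
  -- is exactly the original path.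
  let b : C((T × I) × I, Y) := ⟨fun z =>
    if (z.2 : ℝ) * (1 + z.1.2) ≤ 1 then γ (z.1.1, z.2 * (1 + z.1.2))
      else η (z.1.1, z.2 * (1 + z.1.2) - 1), by
    refine Continuous.if_le (by fun_prop) (by fun_prop) (by fun_prop) (by fun_prop) ?_
    intro z hz
    simp only [γ, η, hz, ContinuousMap.coe_mk, sub_self, Set.projIcc_right, Set.projIcc_left]
    exact (hH z.1.1).symm⟩
  have hb : ∀ z, b z = if (z.2 : ℝ) * (1 + z.1.2) ≤ 1 then γ (z.1.1, z.2 * (1 + z.1.2))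
      else η (z.1.1, z.2 * (1 + z.1.2) - 1) := fun _ => rfl
  refine ⟨mappingPathLift f ⟨fun z => (h z.1).1.1, ?_⟩ b ?_, ?_, ?_, ?_⟩
  · exact (mappingPathFst f).map.continuous.comp (by fun_prop)
  · rintro ⟨x, t⟩
    rw [hb]
    simp [γ]
    exact (h x).2
  · rintro ⟨x, t⟩
    change b ((x, t), 1) = _
    rw [hb]
    split_ifs with ht
    · have ht0 : t = 0 := by
        apply Subtype.ext
        have := t.2.1
        simp at ht
        simpa using le_antisymm ht this
      subst ht0
      rw [hH]
      simp [γ]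
      rfl
    · simp [η]
  · intro x
    refine Subtype.ext (Prod.ext rfl (ContinuousMap.ext fun t => ?_))
    change b ((x, 0), t) = _
    rw [hb, if_pos (by simpa using t.2.2)]
    simp [γ]
  · intro x hx hHx t
    refine Subtype.ext (Prod.ext ?_ (ContinuousMap.ext fun s => ?_))
    · exact congrArg (fun z => z.1.1) hx
    · change b ((x, t), s) = Y.pt
      rw [hb]
      split_ifs
      · simp only [γ, ContinuousMap.coe_mk, hx]
        rfl
      · exact hHx _

/-! ### Lifting cones along based fibrations -/

/-- The suspension of `K` maps to `Z` by families of loops indexed by `K`. -/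
theorem exists_suspension_hom {K Z : PtdTop.{u}} (d : C(K × I, Z)) (h0 : ∀ k, d (k, 0) = Z.pt)
    (h1 : ∀ k, d (k, 1) = Z.pt) (hpt : ∀ t, d (K.pt, t) = Z.pt) :
    ∃ d' : suspension K ⟶ Z, ∀ z, d'.map
      (collapseMk (K × I) {z | z.2 = 0 ∨ z.2 = 1 ∨ z.1 = K.pt} ⟨(K.pt, 0), Or.inl rfl⟩ z) = d z := by
  refine ⟨collapseDesc _ d ?_, fun z => rfl⟩
  rintro ⟨k, t⟩ (h | h | h) <;> simp only at h <;> subst h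
  exacts [h0 k, h1 k, hpt t]

/-- A null homotopy `N` of `h` fills the cone in `E`, but over the wrong map to `B`. The difference
between `g` and the projection of `N` is a map on `ΣK`; lifting it and prepending it to `N` corrects
the filling up to a homotopy, which is then lifted. -/
theorem IsBasedFibration.hasLiftingProperty_coneBase {E B : PtdTop.{u}} {p : E ⟶ B}
    (hp : IsBasedFibration p) {K : PtdTop.{u}}
    (hi : Function.Injective (HomotopyClasses.postcomp K p))
    (hs : Function.Surjective (HomotopyClasses.postcomp (suspension K) p)) :
    HasLiftingProperty (coneBase K) p where
  sq_hasLift {h b} sq := by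
    have h01 : (0 : ℝ) ≤ 1 := zero_le_one
    let g : C(K × I, B) := b.map.comp
      (collapseMk (K × I) {z | z.2 = 0 ∨ z.1 = K.pt} ⟨(K.pt, 0), Or.inl rfl⟩)
    have hg : ∀ z : K × I, z.2 = 0 ∨ z.1 = K.pt → g z = B.pt := fun z hz =>
      (congrArg b.map (collapseMk_eq (T := K × I) (S := {z | z.2 = 0 ∨ z.1 = K.pt})
        ⟨(K.pt, 0), Or.inl rfl⟩ hz)).trans b.map_pt
    have hg1 : ∀ k, g (k, 1) = p.map (h.map k) := fun k =>
      (congrArg (fun q => Hom.map q k) sq.w).symm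
    -- the attaching map is null homotopic
    have hnull : Homotopic (const K E) h := by
      refine postcomp_injective_iff.1 hi _ _ (homotopic_iff.2 ⟨g, fun k => ?_, hg1, fun t => ?_⟩)
      · exact (hg _ (Or.inl rfl)).trans p.map_pt.symm
      · exact hg _ (Or.inr rfl)
    obtain ⟨N, hN0, hN1, hNpt⟩ := homotopic_iff.1 hnull
    replace hN0 : ∀ k, N (k, 0) = E.pt := hN0
    -- The difference loop on `[0, 2]`: out along `g`, back along the projection of `N`.
    let D : C(K × ℝ, B) := ⟨fun z => if z.2 ≤ 1 then g (z.1, Set.projIcc 0 1 h01 z.2)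
        else p.map (N (z.1, Set.projIcc 0 1 h01 (2 - z.2))), by
      refine Continuous.if_le (by fun_prop) (by fun_prop) (by fun_prop) (by fun_prop) ?_
      rintro ⟨k, t⟩ (rfl : t = 1)
      have h2 : (2 : ℝ) - 1 = 1 := by norm_num
      simp only [h2, Set.projIcc_right]
      exact (hg1 k).trans (congrArg p.map (hN1 k).symm)⟩
    have hD1 : ∀ k (t : I), D (k, t) = g (k, t) := fun k t => by
      change (if (t : ℝ) ≤ 1 then _ else _) = _
      rw [if_pos t.2.2, Set.projIcc_val]
    have hD2 : ∀ k (t : I), D (k, 2 - t) = p.map (N (k, t)) := fun k t => by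
      change (if (2 - t : ℝ) ≤ 1 then _ else _) = _
      split_ifs with ht
      · have : t = 1 := Subtype.ext (le_antisymm t.2.2 (by rw [Set.Icc.coe_one]; linarith))
        subst this
        have h2 : (2 : ℝ) - (1 : I) = 1 := by norm_num
        simp only [h2, Set.projIcc_right]
        exact (hg1 k).trans (congrArg p.map (hN1 k).symm)
      · simp
    have hD0 : ∀ k, D (k, 0) = B.pt := fun k => by
      simpa using (hD1 k 0).trans (hg _ (Or.inl rfl))
    have hDpt : ∀ t, D (K.pt, t) = B.pt := fun t => by
      change (if t ≤ 1 then _ else _) = _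
      split_ifs
      · exact hg _ (Or.inr rfl)
      · exact (congrArg p.map (hNpt _)).trans p.map_pt
    -- lift the difference element
    obtain ⟨d, hd⟩ := exists_suspension_hom (K := K) (Z := B)
      ⟨fun z => D (z.1, 2 * z.2), by fun_prop⟩ (fun k => by simpa using hD0 k)
      (fun k => by
        have := hD2 k 0
        rw [hN0, p.map_pt] at this
        simpa using this) (fun t => hDpt _)
    obtain ⟨e', he'⟩ := hp.exists_lift hs d
    let q := collapseMk (K × I) {z | z.2 = 0 ∨ z.2 = 1 ∨ z.1 = K.pt} ⟨(K.pt, 0), Or.inl rfl⟩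
    let e : C(K × I, E) := e'.map.comp q
    have he : ∀ z : K × I, p.map (e z) = D (z.1, 2 * z.2) := fun z =>
      (congrArg (fun k => Hom.map k (q z)) he').trans (hd z)
    have hept : ∀ z : K × I, z.2 = 0 ∨ z.2 = 1 ∨ z.1 = K.pt → e z = E.pt := fun z hz =>
      (congrArg e'.map (collapseMk_eq (T := K × I) (S := {z | z.2 = 0 ∨ z.2 = 1 ∨ z.1 = K.pt})
        ⟨(K.pt, 0), Or.inl rfl⟩ hz)).trans e'.map_pt
    -- the concatenation of the lifted loop with the null homotopy
    let W : C(K × I, E) := ⟨fun z => if (z.2 : ℝ) ≤ 1 / 2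
        then e (z.1, Set.projIcc 0 1 h01 (2 * z.2))
        else N (z.1, Set.projIcc 0 1 h01 (2 * z.2 - 1)), by
      refine Continuous.if_le (by fun_prop) (by fun_prop) (by fun_prop) (by fun_prop) ?_
      rintro ⟨k, t⟩ (ht : (t : ℝ) = 1 / 2)
      have h2 : (2 : ℝ) * (1 / 2) = 1 := by norm_num
      simp only [ht, h2, sub_self, Set.projIcc_right, Set.projIcc_left]
      exact (hept _ (Or.inr (Or.inl rfl))).trans (hN0 k).symm⟩
    -- The projection of `W` runs through all of `D` up to parameter `2`, then retraces `N` back to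
    -- parameter `1`.
    have hW : ∀ z : K × I, p.map (W z) = D (z.1, min (4 * z.2) (3 - 2 * z.2)) := by
      rintro ⟨k, t⟩
      change p.map (if (t : ℝ) ≤ 1 / 2 then _ else _) = _
      have ht0 := t.2.1
      have ht1 := t.2.2
      split_ifs with ht
      · rw [he, Set.projIcc_of_mem h01 ⟨by linarith, by linarith⟩]
        simp only
        rw [min_eq_left (by linarith)]
        congr 2
        ring
      · rw [← hD2, Set.projIcc_of_mem h01 ⟨by linarith, by linarith⟩]
        simp only
        rw [min_eq_right (by linarith)]
        congr 2
        ring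
    have hW0 : ∀ k, W (k, 0) = E.pt := fun k => by
      change (if ((0 : I) : ℝ) ≤ 1 / 2 then _ else _) = _
      rw [if_pos (by norm_num)]
      simpa using hept (k, 0) (Or.inl rfl)
    have hW1 : ∀ k, W (k, 1) = h.map k := fun k => by
      change (if ((1 : I) : ℝ) ≤ 1 / 2 then _ else _) = _
      rw [if_neg (by norm_num)]
      have h2 : (2 : ℝ) * (1 : I) - 1 = 1 := by norm_num
      rw [h2, Set.projIcc_right]
      exact hN1 k
    have hWpt : ∀ t, W (K.pt, t) = E.pt := fun t => by
      change (if (t : ℝ) ≤ 1 / 2 then _ else _) = _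
      split_ifs
      · exact hept _ (Or.inr (Or.inr rfl))
      · exact hNpt _
    -- deform the projection of the concatenation to `g`
    obtain ⟨V, hV, hV0, hVpt⟩ := hp (K × I) W
      -- The parameter is pushed down to `t`, where `D` is `g`; it stays fixed at `t = 0` and `t =
      -- 1`.
      ⟨fun z => D (z.1.1, max (z.1.2 : ℝ) (min (4 * (z.1.2 : ℝ)) (3 - 2 * z.1.2) - 3 * z.2)),
        by fun_prop⟩ (by
        rintro ⟨k, t⟩
        have ht0 := t.2.1
        have ht1 := t.2.2
        rw [hW]
        simp only [ContinuousMap.coe_mk, Set.Icc.coe_zero, mul_zero, sub_zero]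
        rw [max_eq_right (le_min (by linarith) (by linarith))])
    -- The lift `V` may move over `t = 1`, so it is evaluated at time `1 - t` instead of `1`. This
    -- keeps the value `h` on the base, and the deformation has already reached `g` because `3 - 2 *
    -- t - 3 * (1 - t) = t`.
    refine ⟨⟨⟨collapseDesc _ ⟨fun z => V (z, σ z.2), by fun_prop⟩ ?_, hom_ext fun k => ?_,
      hom_ext fun x => ?_⟩⟩⟩
    · rintro ⟨k, t⟩ (ht | hk)
      · simp only at ht
        subst ht
        refine hVpt _ (hW0 k) (fun s => ?_) _
        have hs0 := s.2.1
        have : max ((0 : I) : ℝ) (min (4 * ((0 : I) : ℝ)) (3 - 2 * (0 : I)) - 3 * s) = 0 := by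
          rw [Set.Icc.coe_zero, mul_zero, mul_zero, min_eq_left (by norm_num)]
          exact max_eq_left (by linarith)
        simp only [ContinuousMap.coe_mk, this]
        exact hD0 k
      · simp only at hk
        subst hk
        exact hVpt _ (hWpt t) (fun s => hDpt _) _
    · change V ((k, 1), σ 1) = h.map k
      rw [symm_one, hV0, hW1]
    · induction x using Quotient.inductionOn with
      | h z =>
        obtain ⟨k, t⟩ := z
        change p.map (V ((k, t), σ t)) = g (k, t)
        rw [hV, ← hD1]
        simp only [ContinuousMap.coe_mk, coe_symm_eq]
        rw [max_eq_left]
        have := min_le_right (4 * (t : ℝ)) (3 - 2 * t)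
        linarith

/-! ### Generalized CW(`A`)-complexes and based fibrations -/

theorem iterSuspension_succ (n : ℕ) (A : PtdTop.{u}) :
    iterSuspension (n + 1) A = suspension (iterSuspension n A) :=
  Function.iterate_succ_apply' _ _ _

theorem wedge_hom_ext {J : Type u} {X : J → PtdTop.{u}} {Z : PtdTop.{u}} {f g : wedge X ⟶ Z}
    (h : ∀ j, wedgeIn X j ≫ f = wedgeIn X j ≫ g) : f = g := by
  refine hom_ext fun x => ?_
  induction x using Quotient.inductionOn with
  | h z =>
    rcases z with ⟨⟩ | ⟨j, x⟩
    · exact f.map_pt.trans g.map_pt.symm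
    · exact congrArg (fun k => Hom.map k x) (h j)

/-- A map that lifts the cells of all dimensions lifts the inclusion of the boundaries of a
family of cells. -/
theorem hasLiftingProperty_cellBoundary {A E B : PtdTop.{u}} {p : E ⟶ B}
    (h0 : ∀ v : A ⟶ B, ∃ w : A ⟶ E, w ≫ p = v)
    (h1 : ∀ n, HasLiftingProperty (coneBase (iterSuspension n A)) p) {J₀ J : Type u} (m : J → ℕ) :
    HasLiftingProperty (cellBoundary A (J₀ := J₀) m) p where
  sq_hasLift {a b} sq := by
    have hsq : ∀ α, CommSq (wedgeIn (fun α : J => iterSuspension (m α) A) α ≫ a)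
        (coneBase (iterSuspension (m α) A)) p
        (wedgeIn (cells A (J₀ := J₀) m) (Sum.inr α) ≫ b) := fun α =>
      ⟨congrArg (fun k => wedgeIn (fun α : J => iterSuspension (m α) A) α ≫ k) sq.w⟩
    choose w hw using fun j : J₀ => h0 (wedgeIn (cells A (J₀ := J₀) m) (Sum.inl j) ≫ b)
    have hl : ∀ α, (hsq α).HasLift := fun α => (h1 (m α)).sq_hasLift _
    let l : ∀ j : J₀ ⊕ J, cells A (J₀ := J₀) m j ⟶ E :=
      Sum.rec w fun α => (hsq α).lift
    refine ⟨⟨⟨wedgeDesc l, ?_, ?_⟩⟩⟩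
    · exact wedge_hom_ext fun α => (hsq α).fac_left
    · refine wedge_hom_ext ?_
      rintro (j | α)
      · exact hw j
      · exact (hsq α).fac_right

/-- Generalized CW(`A`)-complexes lift along the based fibrations that are `A`-weak
equivalences. -/
theorem IsGeneralizedCW.exists_lift {A X E B : PtdTop.{u}} (hX : IsGeneralizedCW A X) {p : E ⟶ B}
    (hp : IsBasedFibration p) (hw : weakEquivalencesA A p) (v : X ⟶ B) :
    ∃ w : X ⟶ E, w ≫ p = v := by
  obtain ⟨F, c, h0, hF, rfl, ⟨hc⟩⟩ := hX
  have hcone : ∀ n, HasLiftingProperty (coneBase (iterSuspension n A)) p := fun n => by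
    refine hp.hasLiftingProperty_coneBase (hw n).1 ?_
    rw [← iterSuspension_succ]
    exact (hw (n + 1)).2
  have hF' : ∀ n, HasLiftingProperty (F.map (homOfLE (Nat.le_succ n))) p := fun n => by
    obtain ⟨J₀, J, m, g, f, sq⟩ := hF n
    have := hasLiftingProperty_cellBoundary (hp.exists_lift (hw 0).2) hcone (J₀ := J₀) m
    exact @IsPushout.hasLiftingProperty _ _ _ _ _ _ _ _ _ _ sq _ _ p this
  have := HasLiftingProperty.transfiniteComposition.hasLiftingProperty_ι_app_bot (p := p) hc
    fun n _ => hF' n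
  -- The initial stage is a point, so this square commutes automatically and its lift is the
  -- required map.
  have sq : CommSq (const (F.obj ⊥) E) (c.ι.app ⊥) p v := ⟨hom_ext fun x => by
    have hx : x = (F.obj ⊥).pt := Subsingleton.elim (α := F.obj 0) _ _
    rw [hx, Hom.map_pt, Hom.map_pt]⟩
  exact ⟨sq.lift, sq.fac_right⟩

/-- Cofibrant spaces lift along the based fibrations that are `A`-weak equivalences. -/
theorem IsCofibrantA.exists_lift {A X E B : PtdTop.{u}} (hX : IsCofibrantA A X) {p : E ⟶ B}
    (hp : IsBasedFibration p) (hw : weakEquivalencesA A p) (v : X ⟶ B) :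
    ∃ w : X ⟶ E, w ≫ p = v := by
  have := hX p ⟨⟨hp.hasHLP _, fun _ => hp.hasHLP _, fun _ => hp.hasHLP _⟩, hw⟩
  have sq : CommSq (const point E) (const point X) p v :=
    ⟨hom_ext fun _ => p.map_pt.trans v.map_pt.symm⟩
  exact ⟨sq.lift, sq.fac_right⟩

/-! ### The Whitehead theorem -/

/-- An `A`-weak equivalence has a right homotopy inverse, which is again an `A`-weak equivalence,
if its target lifts along the based fibrations that are `A`-weak equivalences. -/
theorem exists_right_homotopy_inverse {A X Y : PtdTop.{u}}
    (hY : ∀ {E : PtdTop.{u}} {p : E ⟶ Y}, IsBasedFibration p → weakEquivalencesA A p →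
      ∃ s : Y ⟶ E, s ≫ p = 𝟙 Y) {f : X ⟶ Y} (hf : weakEquivalencesA A f) :
    ∃ g : Y ⟶ X, Homotopic (g ≫ f) (𝟙 Y) ∧ weakEquivalencesA A g := by
  have hi := mappingPathIn_isHomotopyEquivalence f
  have hw : weakEquivalencesA A (mappingPathEnd f) := fun n => by
    have h := hf n
    rw [← mappingPathIn_comp_end f, postcomp_comp] at h
    exact (Function.Bijective.of_comp_iff _ (hi.postcomp_bijective _)).1 h
  obtain ⟨s, hs⟩ := hY (mappingPathEnd_isBasedFibration f) hw
  obtain ⟨q, hq, hq'⟩ := hi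
  have hg : Homotopic ((s ≫ q) ≫ f) (𝟙 Y) := by
    have := (hq'.comp_right (mappingPathEnd f)).comp_left s
    rwa [Category.id_comp, hs, Category.assoc, mappingPathIn_comp_end, ← Category.assoc] at this
  -- Two-out-of-three: composing with the bijection induced by `f` gives the identity.
  refine ⟨s ≫ q, hg, fun n => ?_⟩
  refine (Function.Bijective.of_comp_iff' (hf n) _).1 ?_
  rw [← postcomp_comp, postcomp_eq_of_homotopic _ hg, postcomp_id]
  exact Function.bijective_id

theorem isHomotopyEquivalence_of_weakEquivalence {A X Y : PtdTop.{u}}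
    (hX : ∀ {E : PtdTop.{u}} {p : E ⟶ X}, IsBasedFibration p → weakEquivalencesA A p →
      ∃ s : X ⟶ E, s ≫ p = 𝟙 X)
    (hY : ∀ {E : PtdTop.{u}} {p : E ⟶ Y}, IsBasedFibration p → weakEquivalencesA A p →
      ∃ s : Y ⟶ E, s ≫ p = 𝟙 Y) {f : X ⟶ Y} (hf : weakEquivalencesA A f) :
    IsHomotopyEquivalence f := by
  obtain ⟨g, hg, hgw⟩ := exists_right_homotopy_inverse hY hf
  obtain ⟨k, hk, -⟩ := exists_right_homotopy_inverse hX hgw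
  refine ⟨g, ?_, hg⟩
  have hfk : Homotopic f k := by
    have h1 := hk.comp_right f
    have h2 := hg.comp_left k
    rw [Category.id_comp, Category.assoc] at h1
    rw [Category.comp_id] at h2
    exact h1.symm.trans h2
  exact (hfk.comp_right g).trans hk

end PtdTop

theorem mainTheorem5 (A : PtdTop.{u}) [CompactSpace A] [T1Space A] (hA : A.IsHCogroup)
    {X Y : PtdTop.{u}} (f : X ⟶ Y) (hf : PtdTop.weakEquivalencesA A f) :
    (PtdTop.IsCofibrantA A X → PtdTop.IsCofibrantA A Y → PtdTop.IsHomotopyEquivalence f) ∧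
    (PtdTop.IsGeneralizedCW A X → PtdTop.IsGeneralizedCW A Y →
      PtdTop.IsHomotopyEquivalence f) :=
  ⟨fun hX hY => PtdTop.isHomotopyEquivalence_of_weakEquivalence
      (fun hp hw => hX.exists_lift hp hw _) (fun hp hw => hY.exists_lift hp hw _) hf,
    fun hX hY => PtdTop.isHomotopyEquivalence_of_weakEquivalence
      (fun hp hw => hX.exists_lift hp hw _) (fun hp hw => hY.exists_lift hp hw _) hf⟩
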